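/- A mesh is a finite set $\mathcal T$ of non-degenerate compact triangles in $\mathbb R^d$ (e.g. $d=2$, or a triangulated surface in $\mathbb R^3$) such that any two distinct triangles are disjoint, or intersect in exactly a common node, or in exactly a common edge; each $T\in\mathcal T$ carries a reference edge $E_T$. Bisection of $T$ cuts it from the node opposite to $E_T$ to the midpoint of $E_T$; the reference edges of the two sons are the edges opposite to this midpoint. For $\mathcal M\subseteq\mathcal T$, the mesh $\mathrm{refineNVB}(\mathcal T,\mathcal M)$ is obtained as follows. Let $\mathcal M^{(0)}:=\{E_T:T\in\mathcal M\}$ and $\mathcal M^{(k+1)}:=\{E_T:T\in\mathcal T\text{ has an edge in }\mathcal M^{(k)}\}$, until this increasing sequence is stationary; then bisect each $T\in\mathcal T$ with $E_T$ marked, and bisect those of its sons whose reference edge (an edge of $T$) is marked. An NVB refinement of $\mathcal T_0$ is a mesh obtained from $\mathcal T_0$ by finitely many such calls with arbitrary sets of marked elements. The level is $\mathrm{gen}(T):=0$ for $T\in\mathcal T_0$, and sons of $T$ have level $\mathrm{gen}(T)+1$. A reference neighbour $N(T)$ of $T\in\mathcal T$ is an element of $\mathcal T\setminus\{T\}$ which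 has $E_T$ as an edge. We write $\mathrm{dist}(T,T'):=\inf\{|x-y|:x\in T,\ y\in T'\}$. Let $\mathcal T_0$ be an initial mesh with arbitrary reference edges. There are constants $C^{\rm diam}>0$ and $C_{\rm chain}\in\mathbb N$, depending only on $\mathcal T_0$, such that for all NVB refinements $\mathcal T_\star$ of $\mathcal T_0$ (a) $\mathrm{diam}(T)\le C^{\rm diam}\,2^{-\mathrm{gen}(T)/2}$ for all $T\in\mathcal T_\star$; (b) $n\le C_{\rm chain}$ for all sequences $T_1,\dots,T_n$ of pairwise distinct elements of $\mathcal T_\star$ of the same level such that $T_{j+1}$ is a reference neighbour of $T_j$ for $j=1,\dots,n-1$. For all constants $C^{\rm diam}$, $C_{\rm chain}$ with these properties, let $C_{\rm dist}:=2C_{\rm chain}+2^{3/2}$. Then for every NVB refinement $\mathcal T_\ell$ of $\mathcal T_0$, every $T\in\mathcal T_\ell$ and every element $T'\in\mathrm{refineNVB}(\mathcal T_\ell,\{T\})\setminus\mathcal T_\ell$ created by the call $\mathrm{refineNVB}(\mathcal T_\ell,\{T\})$, $$\mathrm{gen}(T')\le\mathrm{gen}(T)+2$$ and $$\mathrm{dist}(T,T')\le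 C_{\rm dist}\,C^{\rm diam}\sum_{k=\mathrm{gen}(T')}^{\mathrm{gen}(T)+2}2^{-k/2}\le\frac{C_{\rm dist}\,C^{\rm diam}}{1-2^{-1/2}}\,2^{-\mathrm{gen}(T')/2}.$$ -/

import Mathlib

/-! Newest vertex bisection (NVB) of triangular meshes in `ℝ^d` (in particular planar meshes in `ℝ²`
and triangulated surfaces in `ℝ³`). -/

namespace NVB

/-- An element of a mesh: a triangle with vertices `apex`, `left`, `right`, whose reference edge is
the edge between `left` and `right`, opposite to `apex`, together with its level `gen`. -/
@[ext]
structure Element (d : ℕ) where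
  apex : EuclideanSpace ℝ (Fin d)
  left : EuclideanSpace ℝ (Fin d)
  right : EuclideanSpace ℝ (Fin d)
  gen : ℕ

namespace Element

variable {d : ℕ}

/-- The nodes of an element. -/
def nodes (T : Element d) : Set (EuclideanSpace ℝ (Fin d)) := {T.apex, T.left, T.right}

/-- The closed triangle. -/
def body (T : Element d) : Set (EuclideanSpace ℝ (Fin d)) := convexHull ℝ T.nodes

/-- The reference edge `E_T`; an edge is identified with the unordered pair of its endpoints. -/
def refEdge (T : Element d) : Sym2 (EuclideanSpace ℝ (Fin d)) := s(T.left, T.right)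

/-- The three edges of an element. -/
def edges (T : Element d) : Set (Sym2 (EuclideanSpace ℝ (Fin d))) :=
  {s(T.left, T.right), s(T.apex, T.left), s(T.apex, T.right)}

/-- The triangle is not contained in a line. -/
def Nondegenerate (T : Element d) : Prop := AffineIndependent ℝ ![T.apex, T.left, T.right]

/-- The midpoint of the reference edge, which becomes the new node when `T` is bisected. -/
noncomputable def newNode (T : Element d) : EuclideanSpace ℝ (Fin d) :=
  midpoint ℝ T.left T.right

/-- The two sons of `T` under bisection: the triangle is cut from the apex to the midpoint of the
reference edge, the reference edges of the sons are opposite to the new node, and the level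
increases by one. -/
def sons (T : Element d) : Set (Element d) :=
  {⟨T.newNode, T.apex, T.left, T.gen + 1⟩, ⟨T.newNode, T.apex, T.right, T.gen + 1⟩}

/-- The diameter of the triangle. -/
noncomputable def diam (T : Element d) : ℝ := Metric.diam T.body

end Element

variable {d : ℕ}

/-- The closed line segment described by an unordered pair of endpoints. -/
def edgeBody (e : Sym2 (EuclideanSpace ℝ (Fin d))) : Set (EuclideanSpace ℝ (Fin d)) :=
  convexHull ℝ {x | x ∈ e}

/-- The distance `dist(T, T')` of two elements, i.e. the infimum of the distances of their points. -/
noncomputable def elementDist (T T' : Element d) : ℝ := sInf (Set.image2 dist T.body T'.body)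

/-- A mesh: a finite set of non-degenerate triangles such that two different ones have empty
intersection, or meet in a common node, or in a common edge. Each triangle carries its reference
edge. The meshed domain is the union of the triangles. -/
structure IsMesh (𝒯 : Set (Element d)) : Prop where
  finite : 𝒯.Finite
  nondegenerate : ∀ T ∈ 𝒯, T.Nondegenerate
  conforming : ∀ T₁ ∈ 𝒯, ∀ T₂ ∈ 𝒯, T₁ ≠ T₂ →
    T₁.body ∩ T₂.body = ∅ ∨
    (∃ p, p ∈ T₁.nodes ∧ p ∈ T₂.nodes ∧ T₁.body ∩ T₂.body = {p}) ∨
    (∃ e, e ∈ T₁.edges ∧ e ∈ T₂.edges ∧ T₁.body ∩ T₂.body = edgeBody e)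

/-- An initial mesh, with an arbitrary choice of reference edges: all levels are zero. -/
structure IsInitialMesh (𝒯 : Set (Element d)) : Prop extends IsMesh 𝒯 where
  gen_eq_zero : ∀ T ∈ 𝒯, T.gen = 0

/-- The sets of marked edges `ℳ^(k)` in the mesh closure loop: start with the reference edges of the
marked elements, and then take the reference edges of all elements which have a marked edge. -/
def markedStep (𝒯 ℳ : Set (Element d)) : ℕ → Set (Sym2 (EuclideanSpace ℝ (Fin d)))
  | 0 => {e | ∃ T ∈ ℳ, e = T.refEdge}
  | k + 1 => {e | ∃ T ∈ 𝒯, (∃ e' ∈ markedStep 𝒯 ℳ k, e' ∈ T.edges) ∧ e = T.refEdge}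

/-- The edges which are marked when the mesh closure loop terminates. (For `ℳ ⊆ 𝒯`, the sets
`markedStep 𝒯 ℳ k` increase with `k`, and the loop ends as soon as they become stationary.) -/
def markedEdges (𝒯 ℳ : Set (Element d)) : Set (Sym2 (EuclideanSpace ℝ (Fin d))) :=
  ⋃ k, markedStep 𝒯 ℳ k

/-- The element itself if its reference edge does not belong to `M`, and otherwise its two sons. -/
def bisectIfMarked (M : Set (Sym2 (EuclideanSpace ℝ (Fin d)))) (T : Element d) :
    Set (Element d) :=
  {S | (T.refEdge ∉ M ∧ S = T) ∨ (T.refEdge ∈ M ∧ S ∈ T.sons)}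

/-- Refinement of one element with respect to the set `M` of marked edges: if its reference edge is
marked, it is bisected, and each son is bisected again if its reference edge (which is one of the
other two edges of the original element) is marked. This gives 1, 2, 3 or 4 elements. -/
def refineElement (M : Set (Sym2 (EuclideanSpace ℝ (Fin d)))) (T : Element d) :
    Set (Element d) :=
  ⋃ S ∈ bisectIfMarked M T, bisectIfMarked M S

/-- One call of the NVB algorithm for the mesh `𝒯` and the set `ℳ` of marked elements. -/
def refineNVB (𝒯 ℳ : Set (Element d)) : Set (Element d) :=
  ⋃ T ∈ 𝒯, refineElement (markedEdges 𝒯 ℳ) T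

/-- `𝒯` is obtained from `𝒯₀` by finitely many calls of the NVB algorithm with arbitrary sets of
marked elements. -/
def IsRefinement (𝒯₀ 𝒯 : Set (Element d)) : Prop :=
  Relation.ReflTransGen (fun 𝒜 ℬ => ∃ ℳ ⊆ 𝒜, ℬ = refineNVB 𝒜 ℳ) 𝒯₀ 𝒯

/-- `T'` is a reference neighbour of `T` in the mesh `𝒯`, in symbols `T' = N(T)`: it is another
element which has the reference edge of `T` as an edge. -/
def IsRefNeighbor (𝒯 : Set (Element d)) (T T' : Element d) : Prop :=
  T' ∈ 𝒯 ∧ T' ≠ T ∧ T.refEdge ∈ T'.edges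

/-- `C` is an admissible constant `C^diam` for `𝒯₀`: `diam(T) ≤ C 2^{-gen(T)/2}` for all elements of
all NVB refinements of `𝒯₀`. -/
def IsDiamConst (𝒯₀ : Set (Element d)) (C : ℝ) : Prop :=
  0 < C ∧ ∀ 𝒯, IsRefinement 𝒯₀ 𝒯 → ∀ T ∈ 𝒯, T.diam ≤ C * (2 : ℝ) ^ (-(T.gen : ℝ) / 2)

/-- `N` is an admissible constant `C_chain` for `𝒯₀`: in all NVB refinements of `𝒯₀`, a sequence
`T_1, …, T_n` of pairwise distinct elements of one level with `T_{j+1} = N(T_j)` satisfies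
`n ≤ N`. -/
def IsChainConst (𝒯₀ : Set (Element d)) (N : ℕ) : Prop :=
  ∀ 𝒯, IsRefinement 𝒯₀ 𝒯 → ∀ (g : ℕ) (c : List (Element d)),
    (∀ T ∈ c, T ∈ 𝒯 ∧ T.gen = g) → c.Nodup → c.IsChain (IsRefNeighbor 𝒯) → c.length ≤ N

end NVB

/-! Write an element by its two leg vectors u, v from the apex. Bisection replaces them by (u+v)/2
and (u-v)/2 up to signs, so |u|^2 + |v|^2 is halved, which gives the diameter bound, and two
bisections give back u/2, v/2 up to signs and order. Hence an initial element K has at most 8 pairs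
of legs among its descendants of one level (`Descends.exists_legs_eq`), and an edge determines the
level of its element almost completely through its size 2^{-j} in the leg coordinates of K
(`Descends.hasScale_edges`). An edge shared by descendants of different initial elements lies in a
common initial edge, where j is the same from both sides (`IsInitialMesh.scale_eq`). So levels
cannot increase from an element to a reference neighbour which has the shared edge as a leg.

Chains of one level: if the reference edge changes from one element to the next, their ancestors
differ. An element Q whose reference edge is reached by one change and left by another therefore has
two edges on the boundary of its ancestor and shares a node with it. This leaves finitely many
possibilities, with a number independent of the level (`exists_isChainConst`).

Distance: a marked edge is reached from T by a chain of reference neighbours with decreasing levels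
and at most C_chain elements per level. Their diameters sum to a partial geometric series; shifting
its index by 2 costs the factor 2, and the old element containing T' contributes one more term. -/

namespace NVB
variable {d : ℕ}

/-! ### Leg vectors and bisection -/

namespace Element

/-- The vector from the apex to the left end of the reference edge. -/
def legLeft (T : Element d) : EuclideanSpace ℝ (Fin d) := T.left - T.apex

/-- The vector from the apex to the right end of the reference edge. -/
def legRight (T : Element d) : EuclideanSpace ℝ (Fin d) := T.right - T.apex

/-- `Descends K T` says that `T` arises from `K` by repeated bisection. -/
def Descends (K T : Element d) : Prop := Relation.ReflTransGen (fun A B => B ∈ A.sons) K T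

lemma legs_of_mem_sons {T S : Element d} (h : S ∈ T.sons) :
    S.gen = T.gen + 1 ∧ S.legLeft = -(1 / 2 : ℝ) • (T.legLeft + T.legRight) ∧
      (S.legRight = (1 / 2 : ℝ) • (T.legLeft - T.legRight) ∨
        S.legRight = -(1 / 2 : ℝ) • (T.legLeft - T.legRight)) := by
  have hm : T.newNode = (1 / 2 : ℝ) • (T.left + T.right) := by
    simp [newNode, midpoint_eq_smul_add]
  rcases h with rfl | rfl
  · refine ⟨rfl, ?_, Or.inl ?_⟩ <;> simp only [legLeft, legRight, hm] <;> module
  · refine ⟨rfl, ?_, Or.inr ?_⟩ <;> simp only [legLeft, legRight, hm] <;> module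

lemma nodes_subset_body (T : Element d) : T.nodes ⊆ T.body := subset_convexHull ℝ _

lemma body_subset_of_mem_sons {T S : Element d} (h : S ∈ T.sons) : S.body ⊆ T.body := by
  have ha : T.apex ∈ T.body := T.nodes_subset_body (by simp [nodes])
  have hl : T.left ∈ T.body := T.nodes_subset_body (by simp [nodes])
  have hr : T.right ∈ T.body := T.nodes_subset_body (by simp [nodes])
  have hm : T.newNode ∈ T.body :=
    (convex_convexHull ℝ T.nodes).midpoint_mem hl hr
  refine convexHull_min ?_ (convex_convexHull ℝ _)
  rcases h with rfl | rfl <;> rintro p (rfl | rfl | rfl) <;> assumption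

lemma Descends.body_subset {K T : Element d} (h : K.Descends T) : T.body ⊆ K.body := by
  induction h with
  | refl => exact subset_rfl
  | tail _ hs ih => exact (body_subset_of_mem_sons hs).trans ih

/-- The two legs of `T` are linearly independent. -/
def LegsIndep (T : Element d) : Prop :=
  ∀ α β : ℝ, α • T.legLeft + β • T.legRight = 0 → α = 0 ∧ β = 0

lemma Nondegenerate.legsIndep {T : Element d} (h : T.Nondegenerate) : T.LegsIndep := by
  have h' := (affineIndependent_iff_linearIndependent_vsub ℝ _ (0 : Fin 3)).1 h
  intro α β hαβ
  rw [linearIndependent_iff'] at h'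
  have hs := h' Finset.univ (fun i => if i.1 = 1 then α else β) (by
    have e : (Finset.univ : Finset {x : Fin 3 // x ≠ 0}) = {⟨1, by decide⟩, ⟨2, by decide⟩} := by
      decide
    rw [e, Finset.sum_pair (by decide)]
    simpa [legLeft, legRight] using hαβ)
  exact ⟨by simpa using hs ⟨1, by decide⟩ (Finset.mem_univ _),
    by simpa using hs ⟨2, by decide⟩ (Finset.mem_univ _)⟩

lemma LegsIndep.unique {T : Element d} (h : T.LegsIndep) {α β α' β' : ℝ}
    (e : α • T.legLeft + β • T.legRight = α' • T.legLeft + β' • T.legRight) :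
    α = α' ∧ β = β' := by
  have := h (α - α') (β - β') (by
    have := sub_eq_zero.2 e
    rw [← this]; module)
  exact ⟨sub_eq_zero.1 this.1, sub_eq_zero.1 this.2⟩

lemma LegsIndep.of_mem_sons {T S : Element d} (h : T.LegsIndep) (hS : S ∈ T.sons) :
    S.LegsIndep := by
  obtain ⟨-, hl, hr⟩ := legs_of_mem_sons hS
  intro α β e
  rcases hr with hr | hr
  · have := h ((-α + β) / 2) ((-α - β) / 2) (by rw [← e, hl, hr]; module)
    constructor <;> linarith [this.1, this.2]
  · have := h ((-α - β) / 2) ((-α + β) / 2) (by rw [← e, hl, hr]; module)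
    constructor <;> linarith [this.1, this.2]

lemma Descends.legsIndep {K T : Element d} (h : K.Descends T) (hK : K.LegsIndep) :
    T.LegsIndep := by
  induction h with
  | refl => exact hK
  | tail _ hs ih => exact ih.of_mem_sons hs

/-! ### Diameters -/

/-- The sum of the squared lengths of the legs, which is halved by bisection. -/
noncomputable def legEnergy (T : Element d) : ℝ := ‖T.legLeft‖ ^ 2 + ‖T.legRight‖ ^ 2

/-- This is the parallelogram law: the legs of a son are half the sum and half the difference of the
old ones. -/
lemma legEnergy_of_mem_sons {T S : Element d} (h : S ∈ T.sons) :
    S.legEnergy = T.legEnergy / 2 := by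
  obtain ⟨-, hl, hr⟩ := legs_of_mem_sons h
  have hp := parallelogram_law_with_norm ℝ T.legLeft T.legRight
  have h1 : ‖S.legLeft‖ = 1 / 2 * ‖T.legLeft + T.legRight‖ := by
    rw [hl, norm_smul]; norm_num
  have h2 : ‖S.legRight‖ = 1 / 2 * ‖T.legLeft - T.legRight‖ := by
    rcases hr with hr | hr <;> rw [hr, norm_smul] <;> norm_num
  rw [legEnergy, legEnergy, h1, h2]
  nlinarith [hp]

lemma Descends.legEnergy_eq {K T : Element d} (h : K.Descends T) (hK : K.gen = 0) :
    T.legEnergy = (1 / 2) ^ T.gen * K.legEnergy := by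
  induction h with
  | refl => simp [hK]
  | tail _ hs ih =>
    rw [legEnergy_of_mem_sons hs, ih, (legs_of_mem_sons hs).1, pow_succ]; ring

lemma diam_le_sqrt (T : Element d) : T.diam ≤ √(2 * T.legEnergy) := by
  have hu := norm_nonneg T.legLeft
  have hv := norm_nonneg T.legRight
  have hl : dist T.left T.apex ≤ √(2 * T.legEnergy) := by
    rw [dist_eq_norm]; apply Real.le_sqrt_of_sq_le
    change ‖T.legLeft‖ ^ 2 ≤ _
    rw [legEnergy]; nlinarith
  have hr : dist T.right T.apex ≤ √(2 * T.legEnergy) := by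
    rw [dist_eq_norm]; apply Real.le_sqrt_of_sq_le
    change ‖T.legRight‖ ^ 2 ≤ _
    rw [legEnergy]; nlinarith
  have hlr : dist T.left T.right ≤ √(2 * T.legEnergy) := by
    rw [dist_eq_norm]; apply Real.le_sqrt_of_sq_le
    have e : T.left - T.right = T.legLeft - T.legRight := by simp [legLeft, legRight]
    have hp := parallelogram_law_with_norm ℝ T.legLeft T.legRight
    rw [e, legEnergy]; nlinarith [sq_nonneg ‖T.legLeft + T.legRight‖]
  have h0 : (0 : ℝ) ≤ √(2 * T.legEnergy) := Real.sqrt_nonneg _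
  rw [diam, body, convexHull_diam]
  refine Metric.diam_le_of_forall_dist_le h0 ?_
  rintro p (rfl | rfl | rfl) q (rfl | rfl | rfl) <;>
    first | assumption | (rw [dist_comm]; assumption) | (rw [dist_self]; assumption)

lemma dist_le_diam (T : Element d) {p q : EuclideanSpace ℝ (Fin d)} (hp : p ∈ T.body)
    (hq : q ∈ T.body) : dist p q ≤ T.diam := by
  refine Metric.dist_le_diam_of_mem ?_ hp hq
  rw [body, isBounded_convexHull]
  exact (Set.toFinite {T.apex, T.left, T.right}).isBounded

lemma descends_of_mem_bisectIfMarked {T S : Element d} {M} (h : S ∈ bisectIfMarked M T) :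
    T.Descends S := by
  rcases h with ⟨-, rfl⟩ | ⟨-, h⟩
  · exact .refl
  · exact .single h

end Element

open Element

lemma IsRefinement.exists_descends {𝒯₀ 𝒯 : Set (Element d)} (h : IsRefinement 𝒯₀ 𝒯) :
    ∀ T ∈ 𝒯, ∃ K ∈ 𝒯₀, K.Descends T := by
  induction h with
  | refl => exact fun T hT => ⟨T, hT, .refl⟩
  | tail _ hs ih =>
    obtain ⟨ℳ, -, rfl⟩ := hs
    intro T hT
    simp only [refineNVB, refineElement, Set.mem_iUnion] at hT
    obtain ⟨A, hA, B, hB, hT⟩ := hT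
    obtain ⟨K, hK, hKA⟩ := ih A hA
    exact ⟨K, hK, (hKA.trans (descends_of_mem_bisectIfMarked hB)).trans
      (descends_of_mem_bisectIfMarked hT)⟩

lemma two_rpow_neg_half (k : ℕ) :
    (2 : ℝ) ^ (-(k : ℝ) / 2) = ((2 : ℝ) ^ (-(1 / 2) : ℝ)) ^ k := by
  rw [← Real.rpow_natCast, ← Real.rpow_mul (by norm_num)]; congr 1; ring

lemma rpow_neg_half_sq : ((2 : ℝ) ^ (-(1 / 2) : ℝ)) ^ 2 = 1 / 2 := by
  rw [← Real.rpow_natCast, ← Real.rpow_mul (by norm_num)]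
  norm_num [Real.rpow_neg_one]

lemma exists_isDiamConst {𝒯₀ : Set (Element d)} (h𝒯₀ : IsInitialMesh 𝒯₀) :
    ∃ C, IsDiamConst 𝒯₀ C := by
  obtain ⟨B, hB⟩ := (h𝒯₀.finite.image fun K => √(2 * K.legEnergy)).bddAbove
  refine ⟨max B 1, by positivity, fun 𝒯 h𝒯 T hT => ?_⟩
  obtain ⟨K, hK, hKT⟩ := h𝒯.exists_descends T hT
  have hq : (0 : ℝ) ≤ ((2 : ℝ) ^ (-(1 / 2) : ℝ)) ^ T.gen := by positivity
  rw [two_rpow_neg_half]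
  calc T.diam ≤ √(2 * T.legEnergy) := T.diam_le_sqrt
    _ = √(2 * K.legEnergy * (((2 : ℝ) ^ (-(1 / 2) : ℝ)) ^ T.gen) ^ 2) := by
      rw [hKT.legEnergy_eq (h𝒯₀.gen_eq_zero K hK), ← pow_mul, mul_comm T.gen 2, pow_mul,
        rpow_neg_half_sq]
      congr 1; ring
    _ = √(2 * K.legEnergy) * ((2 : ℝ) ^ (-(1 / 2) : ℝ)) ^ T.gen := by
      rw [Real.sqrt_mul' _ (by positivity), Real.sqrt_sq hq]
    _ ≤ _ := by
      gcongr
      exact (hB (Set.mem_image_of_mem _ hK)).trans (le_max_left _ _)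

namespace Element

/-! ### Shapes of the descendants of an element -/

/-- The signed permutations of the two legs of `K`. -/
noncomputable def frame (K : Element d) (σ : Bool × Bool × Bool) :
    EuclideanSpace ℝ (Fin d) × EuclideanSpace ℝ (Fin d) :=
  let s : ℝ := if σ.2.1 then 1 else -1
  let t : ℝ := if σ.2.2 then 1 else -1
  if σ.1 then (s • K.legLeft, t • K.legRight) else (s • K.legRight, t • K.legLeft)

/-- This and the next two lemmas provide the changes of frame caused by one bisection, depending on
the parity of the level and on the chosen son. -/
lemma exists_frame_neg (K : Element d) (σ) :
    ∃ τ, K.frame τ = (-(K.frame σ).1, -(K.frame σ).2) := by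
  obtain ⟨a, b, c⟩ := σ
  exact ⟨(a, !b, !c), by cases a <;> cases b <;> cases c <;> simp [frame]⟩

lemma exists_frame_neg_left (K : Element d) (σ) :
    ∃ τ, K.frame τ = (-(K.frame σ).1, (K.frame σ).2) := by
  obtain ⟨a, b, c⟩ := σ
  exact ⟨(a, !b, c), by cases a <;> cases b <;> cases c <;> simp [frame]⟩

lemma exists_frame_neg_swap (K : Element d) (σ) :
    ∃ τ, K.frame τ = (-(K.frame σ).2, -(K.frame σ).1) := by
  obtain ⟨a, b, c⟩ := σ
  exact ⟨(!a, !c, !b), by cases a <;> cases b <;> cases c <;> simp [frame]⟩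

/-- The possible pairs of legs of the descendants of `K` of level `g`. -/
noncomputable def legsAt (K : Element d) (g : ℕ) (σ : Bool × Bool × Bool) :
    EuclideanSpace ℝ (Fin d) × EuclideanSpace ℝ (Fin d) :=
  if Even g then
    ((1 / 2 : ℝ) ^ (g / 2) • (K.frame σ).1, (1 / 2 : ℝ) ^ (g / 2) • (K.frame σ).2)
  else
    ((1 / 2 : ℝ) ^ (g / 2 + 1) • ((K.frame σ).1 + (K.frame σ).2),
      (1 / 2 : ℝ) ^ (g / 2 + 1) • ((K.frame σ).1 - (K.frame σ).2))

lemma legsAt_even (K : Element d) (k : ℕ) (σ) : K.legsAt (2 * k) σ =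
    ((1 / 2 : ℝ) ^ k • (K.frame σ).1, (1 / 2 : ℝ) ^ k • (K.frame σ).2) := by
  rw [legsAt, if_pos (even_two_mul k), Nat.mul_div_cancel_left k two_pos]

lemma legsAt_odd (K : Element d) (k : ℕ) (σ) : K.legsAt (2 * k + 1) σ =
    ((1 / 2 : ℝ) ^ (k + 1) • ((K.frame σ).1 + (K.frame σ).2),
      (1 / 2 : ℝ) ^ (k + 1) • ((K.frame σ).1 - (K.frame σ).2)) := by
  rw [legsAt, if_neg (by simp), show (2 * k + 1) / 2 = k by omega]

lemma Descends.exists_legs_eq {K T : Element d} (h : K.Descends T) (hK : K.gen = 0) :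
    ∃ σ, (T.legLeft, T.legRight) = K.legsAt T.gen σ := by
  induction h with
  | refl =>
    refine ⟨(true, true, true), ?_⟩
    rw [hK, show 0 = 2 * 0 by rfl, legsAt_even]
    simp [frame]
  | @tail T S _ hs ih =>
    obtain ⟨σ, hσ⟩ := ih
    obtain ⟨hg, hu, hv⟩ := legs_of_mem_sons hs
    obtain ⟨k, hk⟩ := Nat.even_or_odd' T.gen
    rw [hg]
    rcases hk with hk | hk
    · rw [hk, legsAt_even] at hσ
      obtain ⟨h1, h2⟩ := Prod.ext_iff.1 hσ
      dsimp only at h1 h2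
      rw [hk]
      rcases hv with hv | hv
      · obtain ⟨τ, hτ⟩ := K.exists_frame_neg_swap σ
        refine ⟨τ, ?_⟩
        rw [legsAt_odd, hτ, hu, hv, h1, h2]
        ext1 <;> dsimp only <;> module
      · obtain ⟨τ, hτ⟩ := K.exists_frame_neg σ
        refine ⟨τ, ?_⟩
        rw [legsAt_odd, hτ, hu, hv, h1, h2]
        ext1 <;> dsimp only <;> module
    · rw [hk, legsAt_odd] at hσ
      obtain ⟨h1, h2⟩ := Prod.ext_iff.1 hσ
      dsimp only at h1 h2
      rw [hk, show 2 * k + 1 + 1 = 2 * (k + 1) by ring]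
      rcases hv with hv | hv
      · obtain ⟨τ, hτ⟩ := K.exists_frame_neg_left σ
        refine ⟨τ, ?_⟩
        rw [legsAt_even, hτ, hu, hv, h1, h2]
        ext1 <;> dsimp only <;> module
      · obtain ⟨τ, hτ⟩ := K.exists_frame_neg σ
        refine ⟨τ, ?_⟩
        rw [legsAt_even, hτ, hu, hv, h1, h2]
        ext1 <;> dsimp only <;> module

/-! ### Scales of edge vectors -/

/-- In the coordinates given by the legs of `K`, the vector `w` has maximum norm `2^{-j}`, and `δ`
tells whether both of its coordinates are nonzero. -/
def HasScale (K : Element d) (δ : Bool) (j : ℕ) (w : EuclideanSpace ℝ (Fin d)) : Prop :=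
  ∃ α β : ℝ, w = α • K.legLeft + β • K.legRight ∧ max |α| |β| = (1 / 2) ^ j ∧
    (δ = true ↔ α ≠ 0 ∧ β ≠ 0)

lemma HasScale.neg {K : Element d} {δ j w} (h : K.HasScale δ j w) : K.HasScale δ j (-w) := by
  obtain ⟨α, β, rfl, h1, h2⟩ := h
  exact ⟨-α, -β, by module, by simpa using h1, by simpa using h2⟩

lemma HasScale.smul {K : Element d} {δ j w} (h : K.HasScale δ j w) (k : ℕ) :
    K.HasScale δ (j + k) ((1 / 2 : ℝ) ^ k • w) := by
  obtain ⟨α, β, rfl, h1, h2⟩ := h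
  refine ⟨(1 / 2) ^ k * α, (1 / 2) ^ k * β, by module, ?_, by simpa using h2⟩
  have hk : (0 : ℝ) ≤ (1 / 2) ^ k := by positivity
  rw [abs_mul, abs_mul, abs_of_nonneg hk, ← mul_max_of_nonneg _ _ hk, h1, pow_add, mul_comm]

lemma half_pow_injective : Function.Injective fun j : ℕ => (1 / 2 : ℝ) ^ j :=
  pow_right_injective₀ (by norm_num) (by norm_num)

lemma HasScale.unique {K : Element d} (hK : K.LegsIndep) {δ δ' j j' w}
    (h : K.HasScale δ j w) (h' : K.HasScale δ' j' w) : δ = δ' ∧ j = j' := by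
  obtain ⟨α, β, rfl, h1, h2⟩ := h
  obtain ⟨α', β', e, h1', h2'⟩ := h'
  obtain ⟨rfl, rfl⟩ := hK.unique e
  exact ⟨Bool.eq_iff_iff.2 (h2.trans h2'.symm), half_pow_injective (h1.symm.trans h1')⟩

/-- Relative to an edge of scale 0, the scale is a ratio of lengths and thus no longer depends on K.
-/
lemma HasScale.abs_eq {K : Element d} (hK : K.LegsIndep) {δ δ' : Bool} {j : ℕ} {c : ℝ}
    {w : EuclideanSpace ℝ (Fin d)} (h : K.HasScale δ 0 w) (h' : K.HasScale δ' j (c • w)) :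
    |c| = (1 / 2) ^ j := by
  obtain ⟨α, β, rfl, h1, -⟩ := h
  obtain ⟨α', β', e, h1', -⟩ := h'
  obtain ⟨rfl, rfl⟩ := hK.unique (α := c * α) (β := c * β) (by rw [← e]; module)
  rw [abs_mul, abs_mul, ← mul_max_of_nonneg _ _ (abs_nonneg c), h1] at h1'
  simpa using h1'

lemma hasScale_frame (K : Element d) (σ) :
    K.HasScale false 0 (K.frame σ).1 ∧ K.HasScale false 0 (K.frame σ).2 ∧
      K.HasScale true 0 ((K.frame σ).1 + (K.frame σ).2) ∧
      K.HasScale true 0 ((K.frame σ).1 - (K.frame σ).2) := by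
  have key : ∀ s t : ℝ, |s| = 1 → |t| = 1 →
      K.HasScale false 0 (s • K.legLeft) ∧ K.HasScale false 0 (t • K.legRight) ∧
      K.HasScale true 0 (s • K.legLeft + t • K.legRight) ∧
      K.HasScale true 0 (s • K.legLeft - t • K.legRight) := by
    intro s t hs ht
    have hs0 : s ≠ 0 := by rintro rfl; simp at hs
    have ht0 : t ≠ 0 := by rintro rfl; simp at ht
    exact ⟨⟨s, 0, by module, by simp [hs], by simp⟩, ⟨0, t, by module, by simp [ht], by simp⟩,
      ⟨s, t, by module, by simp [hs, ht], by simp [hs0, ht0]⟩,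
      ⟨s, -t, by module, by simp [hs, ht], by simp [hs0, ht0]⟩⟩
  obtain ⟨a, b, c⟩ := σ
  have hb : |(if b then 1 else -1 : ℝ)| = 1 := by cases b <;> simp
  have hc : |(if c then 1 else -1 : ℝ)| = 1 := by cases c <;> simp
  cases a
  · obtain ⟨h1, h2, h3, h4⟩ := key _ _ hc hb
    refine ⟨h2, h1, ?_, ?_⟩
    · simpa [frame, add_comm] using h3
    · simpa [frame] using h4.neg
  · exact key _ _ hb hc

/-- At level 2k the legs are 2^{-k} times frame vectors, and the reference edge is 2^{-k} times
their difference. At level 2k+1 the legs are 2^{-(k+1)} times the sum and the difference, and the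
reference edge is 2^{-k} times a frame vector. The level is read off from j and δ, differently for
legs and reference edges. -/
lemma Descends.hasScale_edges {K T : Element d} (h : K.Descends T) (hK : K.gen = 0) :
    (∃ δ j, K.HasScale δ j (T.right - T.left) ∧ T.gen = 2 * j + (if δ then 0 else 1)) ∧
    ∃ δ j, K.HasScale δ j T.legLeft ∧ K.HasScale δ j T.legRight ∧
      T.gen + (if δ then 1 else 0) = 2 * j := by
  obtain ⟨σ, hσ⟩ := h.exists_legs_eq hK
  obtain ⟨f1, f2, f3, f4⟩ := K.hasScale_frame σ
  have e : T.right - T.left = T.legRight - T.legLeft := by simp [legLeft, legRight]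
  obtain ⟨k, hk | hk⟩ := Nat.even_or_odd' T.gen
  · rw [hk, legsAt_even] at hσ
    obtain ⟨h1, h2⟩ := Prod.ext_iff.1 hσ
    dsimp only at h1 h2
    rw [e, h1, h2, hk]
    refine ⟨⟨true, k, ?_, by simp⟩, false, k, ?_, ?_, by simp⟩
    · convert (f4.smul k).neg using 1
      · simp
      · module
    · simpa using f1.smul k
    · simpa using f2.smul k
  · rw [hk, legsAt_odd] at hσ
    obtain ⟨h1, h2⟩ := Prod.ext_iff.1 hσ
    dsimp only at h1 h2
    rw [e, h1, h2, hk]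
    refine ⟨⟨false, k, ?_, by simp⟩, true, k + 1, ?_, ?_, by simp; ring⟩
    · convert (f2.smul k).neg using 1
      · simp
      · module
    · simpa using f3.smul (k + 1)
    · simpa using f4.smul (k + 1)

lemma Descends.hasScale_refEdge {K T : Element d} (h : K.Descends T) (hK : K.gen = 0)
    {p q : EuclideanSpace ℝ (Fin d)} (e : s(p, q) = T.refEdge) :
    ∃ δ j, K.HasScale δ j (q - p) ∧ T.gen = 2 * j + (if δ then 0 else 1) := by
  obtain ⟨⟨δ, j, h1, h2⟩, -⟩ := h.hasScale_edges hK
  refine ⟨δ, j, ?_, h2⟩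
  rcases Sym2.eq_iff.1 e with ⟨rfl, rfl⟩ | ⟨rfl, rfl⟩
  · exact h1
  · simpa using h1.neg

lemma Descends.hasScale_leg {K T : Element d} (h : K.Descends T) (hK : K.gen = 0)
    {p q : EuclideanSpace ℝ (Fin d)} (e : s(p, q) ∈ T.edges) (hne : s(p, q) ≠ T.refEdge) :
    ∃ δ j, K.HasScale δ j (q - p) ∧ T.gen + (if δ then 1 else 0) = 2 * j := by
  obtain ⟨-, δ, j, h1, h2, h3⟩ := h.hasScale_edges hK
  refine ⟨δ, j, ?_, h3⟩
  rcases e with e | e | e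
  · exact absurd e hne
  · rcases Sym2.eq_iff.1 e with ⟨rfl, rfl⟩ | ⟨rfl, rfl⟩
    · exact h1
    · simpa [legLeft] using h1.neg
  · rcases Sym2.eq_iff.1 e with ⟨rfl, rfl⟩ | ⟨rfl, rfl⟩
    · exact h2
    · simpa [legRight] using h2.neg

lemma hasScale_edge {K : Element d} (hK : K.gen = 0) {p q : EuclideanSpace ℝ (Fin d)}
    (e : s(p, q) ∈ K.edges) : ∃ δ, K.HasScale δ 0 (q - p) := by
  by_cases hr : s(p, q) = K.refEdge
  · obtain ⟨δ, j, h, hg⟩ := Descends.hasScale_refEdge (.refl : K.Descends K) hK hr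
    obtain rfl : j = 0 := by omega
    exact ⟨δ, h⟩
  · obtain ⟨δ, j, h, hg⟩ := Descends.hasScale_leg (.refl : K.Descends K) hK e hr
    obtain rfl : j = 0 := by cases δ <;> simp at hg <;> omega
    exact ⟨δ, h⟩

lemma mem_nodes_of_mem_edges {T : Element d} {p q : EuclideanSpace ℝ (Fin d)}
    (e : s(p, q) ∈ T.edges) : p ∈ T.nodes ∧ q ∈ T.nodes := by
  rcases e with e | e | e <;> rcases Sym2.eq_iff.1 e with ⟨rfl, rfl⟩ | ⟨rfl, rfl⟩ <;>
    simp [nodes]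

lemma Descends.mem_body_of_mem_edges {K T : Element d} (h : K.Descends T)
    {p q : EuclideanSpace ℝ (Fin d)} (e : s(p, q) ∈ T.edges) : p ∈ K.body ∧ q ∈ K.body :=
  have hn := mem_nodes_of_mem_edges e
  ⟨h.body_subset (T.nodes_subset_body hn.1), h.body_subset (T.nodes_subset_body hn.2)⟩

lemma refEdge_mem_edges (T : Element d) : T.refEdge ∈ T.edges := Or.inl rfl

end Element

/-! ### Comparison of levels across initial elements -/

lemma edgeBody_mk (a b : EuclideanSpace ℝ (Fin d)) : edgeBody s(a, b) = segment ℝ a b := by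
  rw [edgeBody, ← convexHull_pair]
  congr 1
  ext x; simp

lemma mem_edgeBody_mk {a b x : EuclideanSpace ℝ (Fin d)} :
    x ∈ edgeBody s(a, b) ↔ ∃ t ∈ Set.Icc (0 : ℝ) 1, x = a + t • (b - a) := by
  rw [edgeBody_mk, segment_eq_image']
  simp [eq_comm]

lemma IsMesh.exists_common_edge {𝒯 : Set (Element d)} (h : IsMesh 𝒯) {K K' : Element d}
    (hK : K ∈ 𝒯) (hK' : K' ∈ 𝒯) (hne : K ≠ K') {p q : EuclideanSpace ℝ (Fin d)} (hpq : p ≠ q)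
    (hp : p ∈ K.body ∧ p ∈ K'.body) (hq : q ∈ K.body ∧ q ∈ K'.body) :
    ∃ e ∈ K.edges, e ∈ K'.edges ∧ p ∈ edgeBody e ∧ q ∈ edgeBody e := by
  have hp' : p ∈ K.body ∩ K'.body := hp
  have hq' : q ∈ K.body ∩ K'.body := hq
  rcases h.conforming K hK K' hK' hne with e | ⟨z, -, -, e⟩ | ⟨e, h1, h2, e'⟩
  · simp [e] at hp'
  · rw [e] at hp' hq'
    exact absurd (hp'.trans hq'.symm) hpq
  · rw [e'] at hp' hq'
    exact ⟨e, h1, h2, hp', hq'⟩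

/-- For K ≠ K', both points lie on a common edge of K and K'. This edge has scale 0 in both
coordinate systems, so 2^{-j} and 2^{-j'} are both the ratio of the lengths. Only j is intrinsic: δ
can differ, since the reference edges of the initial mesh are arbitrary. -/
lemma IsInitialMesh.scale_eq {𝒯₀ : Set (Element d)} (h : IsInitialMesh 𝒯₀) {K K' : Element d}
    (hK : K ∈ 𝒯₀) (hK' : K' ∈ 𝒯₀) {p q : EuclideanSpace ℝ (Fin d)}
    (hp : p ∈ K.body ∧ p ∈ K'.body) (hq : q ∈ K.body ∧ q ∈ K'.body) {δ δ' j j'}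
    (hs : K.HasScale δ j (q - p)) (hs' : K'.HasScale δ' j' (q - p)) : j = j' := by
  have hi := (h.nondegenerate K hK).legsIndep
  have hi' := (h.nondegenerate K' hK').legsIndep
  by_cases hne : K = K'
  · subst hne
    exact (hs.unique hi hs').2
  by_cases hpq : p = q
  · obtain ⟨α, β, e, hm, -⟩ := hs
    have e0 := hi α β (by rw [← e, hpq, sub_self])
    rw [e0.1, e0.2] at hm
    have : (0 : ℝ) < (1 / 2) ^ j := by positivity
    rw [← hm] at this
    simp at this
  obtain ⟨e, he, he', hpe, hqe⟩ := h.exists_common_edge hK hK' hne hpq hp hq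
  induction e with
  | _ a b =>
    obtain ⟨s, -, rfl⟩ := mem_edgeBody_mk.1 hpe
    obtain ⟨t, -, rfl⟩ := mem_edgeBody_mk.1 hqe
    have e : (a + t • (b - a)) - (a + s • (b - a)) = (t - s) • (b - a) := by module
    rw [e] at hs hs'
    obtain ⟨ε, h0⟩ := hasScale_edge (h.gen_eq_zero K hK) he
    obtain ⟨ε', h0'⟩ := hasScale_edge (h.gen_eq_zero K' hK') he'
    exact half_pow_injective ((h0.abs_eq hi hs).symm.trans (h0'.abs_eq hi' hs'))

/-- If the reference edge of `T` is a non-reference edge of `T'`, then the level of `T'` is at most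
that of `T`, and different from it if both elements have the same ancestor. -/
lemma IsInitialMesh.gen_le_of_refEdge_mem {𝒯₀ : Set (Element d)} (h : IsInitialMesh 𝒯₀)
    {K K' T T' : Element d} (hK : K ∈ 𝒯₀) (hK' : K' ∈ 𝒯₀) (hT : K.Descends T)
    (hT' : K'.Descends T') (he : T.refEdge ∈ T'.edges) (hne : T.refEdge ≠ T'.refEdge) :
    T'.gen ≤ T.gen ∧ (K = K' → T'.gen ≠ T.gen) := by
  obtain ⟨δ, j, hs, hg⟩ := hT.hasScale_refEdge (h.gen_eq_zero K hK)
    (show s(T.left, T.right) = T.refEdge from rfl)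
  obtain ⟨δ', j', hs', hg'⟩ := hT'.hasScale_leg (h.gen_eq_zero K' hK') he hne
  have hb := hT.mem_body_of_mem_edges T.refEdge_mem_edges
  have hb' := hT'.mem_body_of_mem_edges he
  have hj := h.scale_eq hK hK' ⟨hb.1, hb'.1⟩ ⟨hb.2, hb'.2⟩ hs hs'
  -- As a reference edge, the edge gives T the level 2j or 2j+1; as a leg, it gives T' the level 2j
  -- or 2j-1.
  refine ⟨by split_ifs at hg hg' <;> omega, ?_⟩
  rintro rfl
  -- With one ancestor δ agrees too, and then the levels differ by exactly 1.
  obtain ⟨rfl, -⟩ := hs.unique (h.nondegenerate K hK).legsIndep hs'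
  split_ifs at hg hg' <;> omega

lemma IsInitialMesh.gen_le_of_refEdge_eq {𝒯₀ : Set (Element d)} (h : IsInitialMesh 𝒯₀)
    {K K' T T' : Element d} (hK : K ∈ 𝒯₀) (hK' : K' ∈ 𝒯₀) (hT : K.Descends T)
    (hT' : K'.Descends T') (he : T.refEdge = T'.refEdge) : T'.gen ≤ T.gen + 1 := by
  obtain ⟨δ, j, hs, hg⟩ := hT.hasScale_refEdge (h.gen_eq_zero K hK)
    (show s(T.left, T.right) = T.refEdge from rfl)
  obtain ⟨δ', j', hs', hg'⟩ := hT'.hasScale_refEdge (h.gen_eq_zero K' hK') he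
  have hb := hT.mem_body_of_mem_edges T.refEdge_mem_edges
  have hb' := hT'.mem_body_of_mem_edges (he ▸ T'.refEdge_mem_edges)
  have hj := h.scale_eq hK hK' ⟨hb.1, hb'.1⟩ ⟨hb.2, hb'.2⟩ hs hs'
  split_ifs at hg hg' <;> omega

/-! ### Elements determined by a node, and nodes shared with the ancestor -/

namespace Element

/-- The element of level `g` whose `i`-th node is `z` and whose legs are `K.legsAt g σ`. -/
noncomputable def ofNode (K : Element d) (g : ℕ) (z : EuclideanSpace ℝ (Fin d))
    (c : (Bool × Bool × Bool) × Fin 3) : Element d :=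
  let w := K.legsAt g c.1
  let a := ![z, z - w.1, z - w.2] c.2
  ⟨a, a + w.1, a + w.2, g⟩

/-- Ancestor, level and one node leave only 8 · 3 candidates: the pair of legs, and which node it
is. -/
lemma Descends.exists_eq_ofNode {K T : Element d} (h : K.Descends T) (hK : K.gen = 0)
    {z : EuclideanSpace ℝ (Fin d)} (hz : z ∈ T.nodes) : ∃ c, T = K.ofNode T.gen z c := by
  obtain ⟨σ, hσ⟩ := h.exists_legs_eq hK
  rcases hz with rfl | rfl | rfl
  · exact ⟨(σ, 0), by ext1 <;> simp [ofNode, ← hσ, legLeft, legRight]⟩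
  · exact ⟨(σ, 1), by ext1 <;> simp [ofNode, ← hσ, legLeft, legRight]⟩
  · exact ⟨(σ, 2), by ext1 <;> simp [ofNode, ← hσ, legLeft, legRight]⟩

lemma LegsIndep.left_ne_right {T : Element d} (h : T.LegsIndep) : T.left ≠ T.right := by
  intro e
  have := h 1 (-1) (by simp [legLeft, legRight, e])
  simp at this

lemma LegsIndep.apex_ne_left {T : Element d} (h : T.LegsIndep) : T.apex ≠ T.left := by
  intro e
  have := h 1 0 (by simp [legLeft, e])
  simp at this

lemma LegsIndep.apex_ne_right {T : Element d} (h : T.LegsIndep) : T.apex ≠ T.right := by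
  intro e
  have := h 0 1 (by simp [legRight, e])
  simp at this

lemma LegsIndep.mem_nodes_of_mem_edgeBody {K : Element d} (h : K.LegsIndep)
    {z : EuclideanSpace ℝ (Fin d)} {e e' : Sym2 (EuclideanSpace ℝ (Fin d))} (he : e ∈ K.edges)
    (he' : e' ∈ K.edges) (hne : e ≠ e') (hz : z ∈ edgeBody e) (hz' : z ∈ edgeBody e') :
    z ∈ K.nodes := by
  have h1 : z ∈ edgeBody s(K.left, K.right) → z ∈ edgeBody s(K.apex, K.left) → z ∈ K.nodes := by
    intro hz hz'
    obtain ⟨s, -, e1⟩ := mem_edgeBody_mk.1 hz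
    obtain ⟨t, -, e2⟩ := mem_edgeBody_mk.1 hz'
    have e : z - K.apex = (1 - s) • K.legLeft + s • K.legRight := by
      rw [e1, legLeft, legRight]; module
    have e' : z - K.apex = t • K.legLeft + (0 : ℝ) • K.legRight := by
      rw [e2, legLeft, legRight]; module
    obtain ⟨-, rfl⟩ := h.unique (e.symm.trans e')
    simp [nodes, e1]
  have h2 : z ∈ edgeBody s(K.left, K.right) → z ∈ edgeBody s(K.apex, K.right) → z ∈ K.nodes := by
    intro hz hz'
    obtain ⟨s, -, e1⟩ := mem_edgeBody_mk.1 hz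
    obtain ⟨t, -, e2⟩ := mem_edgeBody_mk.1 hz'
    have e : z - K.apex = (1 - s) • K.legLeft + s • K.legRight := by
      rw [e1, legLeft, legRight]; module
    have e' : z - K.apex = (0 : ℝ) • K.legLeft + t • K.legRight := by
      rw [e2, legLeft, legRight]; module
    have hs := (h.unique (e.symm.trans e')).1
    obtain rfl : s = 1 := by linarith
    simp [nodes, e1]
  have h3 : z ∈ edgeBody s(K.apex, K.left) → z ∈ edgeBody s(K.apex, K.right) → z ∈ K.nodes := by
    intro hz hz'
    obtain ⟨s, -, e1⟩ := mem_edgeBody_mk.1 hz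
    obtain ⟨t, -, e2⟩ := mem_edgeBody_mk.1 hz'
    have e : z - K.apex = s • K.legLeft + (0 : ℝ) • K.legRight := by
      rw [e1, legLeft, legRight]; module
    have e' : z - K.apex = (0 : ℝ) • K.legLeft + t • K.legRight := by
      rw [e2, legLeft, legRight]; module
    obtain ⟨rfl, -⟩ := h.unique (e.symm.trans e')
    simp [nodes, e1]
  rcases he with rfl | rfl | rfl <;> rcases he' with rfl | rfl | rfl <;>
    first
    | exact absurd rfl hne
    | exact h1 hz hz'
    | exact h2 hz hz'
    | exact h3 hz hz'
    | exact h1 hz' hz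
    | exact h2 hz' hz
    | exact h3 hz' hz

lemma LegsIndep.not_subset_edgeBody {T : Element d} (h : T.LegsIndep)
    {e : Sym2 (EuclideanSpace ℝ (Fin d))} (ha : T.apex ∈ edgeBody e) (hl : T.left ∈ edgeBody e)
    (hr : T.right ∈ edgeBody e) : False := by
  induction e with
  | _ a b =>
    obtain ⟨s, -, ea⟩ := mem_edgeBody_mk.1 ha
    obtain ⟨t, -, el⟩ := mem_edgeBody_mk.1 hl
    obtain ⟨r, -, er⟩ := mem_edgeBody_mk.1 hr
    have h1 := h (r - s) (-(t - s)) (by rw [legLeft, legRight, ea, el, er]; module)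
    have hr : r = s := by linarith [h1.1]
    exact h.apex_ne_right (by rw [ea, er, hr])

/-- If the reference edge of `T` and another edge of `T` are contained in edges of `K`, then the two
triangles share a node. -/
lemma exists_common_node {K T : Element d} (hK : K.LegsIndep) (hT : T.LegsIndep)
    {e e' : Sym2 (EuclideanSpace ℝ (Fin d))} (he : e ∈ K.edges) (he' : e' ∈ K.edges)
    (hl : T.left ∈ edgeBody e) (hr : T.right ∈ edgeBody e)
    {p q : EuclideanSpace ℝ (Fin d)} (hpq : s(p, q) ∈ T.edges) (hne : s(p, q) ≠ T.refEdge)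
    (hp : p ∈ edgeBody e') (hq : q ∈ edgeBody e') : ∃ z ∈ T.nodes, z ∈ K.nodes := by
  have key : T.apex ∈ edgeBody e' → T.left ∈ edgeBody e' ∨ T.right ∈ edgeBody e' →
      ∃ z ∈ T.nodes, z ∈ K.nodes := by
    intro ha hlr
    -- A non-degenerate triangle does not fit into one edge, so its common node lies on two
    -- different edges of K.
    have hee : e ≠ e' := by
      rintro rfl
      exact hT.not_subset_edgeBody ha hl hr
    rcases hlr with hz | hz
    · exact ⟨_, by simp [nodes], hK.mem_nodes_of_mem_edgeBody he he' hee hl hz⟩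
    · exact ⟨_, by simp [nodes], hK.mem_nodes_of_mem_edgeBody he he' hee hr hz⟩
  rcases hpq with h | h | h
  · exact absurd h hne
  · rcases Sym2.eq_iff.1 h with ⟨rfl, rfl⟩ | ⟨rfl, rfl⟩
    · exact key hp (.inl hq)
    · exact key hq (.inl hp)
  · rcases Sym2.eq_iff.1 h with ⟨rfl, rfl⟩ | ⟨rfl, rfl⟩
    · exact key hp (.inr hq)
    · exact key hq (.inr hp)

end Element

/-! ### Chains of elements of the same level -/

/-- A value of f other than the initial one must be entered by a jump somewhere in the chain;
dually, `exists_change_after` says that a value other than the final one must be left by a jump. -/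
lemma exists_change_before {α β : Type*} {r : α → α → Prop} (f : α → β) :
    ∀ {a : α} {l : List α}, (a :: l).IsChain r → ∀ x ∈ a :: l, f x = f a ∨
      ∃ p ∈ a :: l, ∃ q ∈ a :: l, r p q ∧ f p ≠ f q ∧ f q = f x := by
  intro a l
  induction l generalizing a with
  | nil => intro _ x hx; simp at hx; simp [hx]
  | cons b l ih =>
    intro h x hx
    rw [List.isChain_cons_cons] at h
    rcases List.mem_cons.1 hx with rfl | hx
    · exact .inl rfl
    rcases ih h.2 x hx with e | ⟨p, hp, q, hq, hpq⟩
    · by_cases hab : f a = f b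
      · exact .inl (e.trans hab.symm)
      · exact .inr ⟨a, by simp, b, by simp, h.1, hab, e.symm⟩
    · exact .inr ⟨p, List.mem_cons_of_mem _ hp, q, List.mem_cons_of_mem _ hq, hpq⟩

lemma exists_change_after {α β : Type*} {r : α → α → Prop} (f : α → β) :
    ∀ {a : α} {l : List α}, (a :: l).IsChain r → ∀ x ∈ a :: l,
      f x = f ((a :: l).getLast (by simp)) ∨
      ∃ p ∈ a :: l, ∃ q ∈ a :: l, r p q ∧ f p ≠ f q ∧ f p = f x := by
  intro a l
  induction l generalizing a with
  | nil => intro _ x hx; simp at hx; simp [hx]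
  | cons b l ih =>
    intro h x hx
    rw [List.isChain_cons_cons] at h
    have key : ∀ y ∈ b :: l, f y = f ((a :: b :: l).getLast (by simp)) ∨
        ∃ p ∈ a :: b :: l, ∃ q ∈ a :: b :: l, r p q ∧ f p ≠ f q ∧ f p = f y := by
      intro y hy
      rcases ih h.2 y hy with e | ⟨p, hp, q, hq, hpq⟩
      · exact .inl (by simpa using e)
      · exact .inr ⟨p, List.mem_cons_of_mem _ hp, q, List.mem_cons_of_mem _ hq, hpq⟩
    rcases List.mem_cons.1 hx with rfl | hx
    · by_cases hab : f x = f b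
      · rw [hab]; exact key b (by simp)
      · exact .inr ⟨x, by simp, b, by simp, h.1, hab, rfl⟩
    · exact key x hx

/-- The jump into the reference edge of Q puts a leg of Q on the boundary of its ancestor, and the
jump out of it does the same for the reference edge of Q. -/
lemma IsInitialMesh.exists_node_of_chain {𝒯₀ 𝒯 : Set (Element d)} (h𝒯₀ : IsInitialMesh 𝒯₀)
    {g : ℕ} {B : Set (Element d)} (hB : ∀ T ∈ B, T.gen = g ∧ ∃ K ∈ 𝒯₀, K.Descends T)
    {P Q P' Q' : Element d} (hP : P ∈ B) (hQ : Q ∈ B) (hQ' : Q' ∈ B)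
    (hPQ : IsRefNeighbor 𝒯 P Q) (hne : P.refEdge ≠ Q.refEdge) (hPQ' : IsRefNeighbor 𝒯 P' Q')
    (hne' : P'.refEdge ≠ Q'.refEdge) (he : P'.refEdge = Q.refEdge) :
    ∃ K ∈ 𝒯₀, K.Descends Q ∧ ∃ z ∈ Q.nodes, z ∈ K.nodes := by
  obtain ⟨gP, KP, hKP, hdP⟩ := hB P hP
  obtain ⟨gQ, KQ, hKQ, hdQ⟩ := hB Q hQ
  obtain ⟨gQ', KQ', hKQ', hdQ'⟩ := hB Q' hQ'
  have hmem' : Q.refEdge ∈ Q'.edges := he ▸ hPQ'.2.2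
  have hKne : KP ≠ KQ := fun e =>
    (h𝒯₀.gen_le_of_refEdge_mem hKP hKQ hdP hdQ hPQ.2.2 hne).2 e (gQ.trans gP.symm)
  have hKne' : KQ ≠ KQ' := fun e =>
    (h𝒯₀.gen_le_of_refEdge_mem hKQ hKQ' hdQ hdQ' hmem' (he ▸ hne')).2 e (gQ'.trans gQ.symm)
  have hi := (h𝒯₀.nondegenerate KQ hKQ).legsIndep
  have hiQ := hdQ.legsIndep hi
  have hiP := hdP.legsIndep (h𝒯₀.nondegenerate KP hKP).legsIndep
  have b1 := hdP.mem_body_of_mem_edges P.refEdge_mem_edges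
  have b2 := hdQ.mem_body_of_mem_edges hPQ.2.2
  have b3 := hdQ.mem_body_of_mem_edges Q.refEdge_mem_edges
  have b4 := hdQ'.mem_body_of_mem_edges hmem'
  obtain ⟨e', -, he', hp, hq⟩ := h𝒯₀.exists_common_edge hKP hKQ hKne hiP.left_ne_right
    ⟨b1.1, b2.1⟩ ⟨b1.2, b2.2⟩
  obtain ⟨e, he, -, hl, hr⟩ := h𝒯₀.exists_common_edge hKQ hKQ' hKne' hiQ.left_ne_right
    ⟨b3.1, b4.1⟩ ⟨b3.2, b4.2⟩
  exact ⟨KQ, hKQ, hdQ, exists_common_node hi hiQ he he' hl hr hPQ.2.2 hne hp hq⟩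

lemma exists_isChainConst {𝒯₀ : Set (Element d)} (h𝒯₀ : IsInitialMesh 𝒯₀) :
    ∃ N, IsChainConst 𝒯₀ N := by
  classical
  have := h𝒯₀.finite.fintype
  let Γ := 𝒯₀ × ((Bool × Bool × Bool) × Fin 3)
  refine ⟨Fintype.card ((𝒯₀ × Fin 3 × Γ) × Γ ⊕ Γ ⊕ Γ), fun 𝒯 h𝒯 g c hc hnd hch => ?_⟩
  rcases c with _ | ⟨A, l⟩
  · simp
  have hB : ∀ T ∈ {T | T ∈ A :: l}, T.gen = g ∧ ∃ K ∈ 𝒯₀, K.Descends T :=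
    fun T hT => ⟨(hc T hT).2, h𝒯.exists_descends T (hc T hT).1⟩
  let Z := (A :: l).getLast (by simp)
  -- Every chain element shares its reference edge with the first element A, with the last element
  -- Z, or with an element Q having a node in common with an initial element. In the first case of
  -- the code, i selects this node, γ describes Q, and γ' describes the chain element through the
  -- left node of Q.
  let F : (𝒯₀ × Fin 3 × Γ) × Γ ⊕ Γ ⊕ Γ → Element d
    | .inl ((K, i, γ), γ') =>
      γ'.1.1.ofNode g (γ.1.1.ofNode g (![K.1.apex, K.1.left, K.1.right] i) γ.2).left γ'.2
    | .inr (.inl γ) => γ.1.1.ofNode g A.left γ.2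
    | .inr (.inr γ) => γ.1.1.ofNode g Z.left γ.2
  have key : ∀ T ∈ A :: l, ∀ S : Element d, T.refEdge = S.refEdge →
      ∃ γ : Γ, T = γ.1.1.ofNode g S.left γ.2 := by
    intro T hT S hS
    obtain ⟨hg, K, hK, hd⟩ := hB T hT
    have hz : S.left ∈ T.nodes := by
      have h1 : s(S.left, S.right) ∈ T.edges := by
        change S.refEdge ∈ _
        exact hS ▸ T.refEdge_mem_edges
      exact (mem_nodes_of_mem_edges h1).1
    obtain ⟨c, e⟩ := hd.exists_eq_ofNode (h𝒯₀.gen_eq_zero K hK) hz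
    exact ⟨(⟨K, hK⟩, c), by rw [← hg]; exact e⟩
  have hsub : (A :: l).toFinset ⊆ Finset.univ.image F := by
    intro T hT
    rw [List.mem_toFinset] at hT
    rw [Finset.mem_image]
    rcases exists_change_before refEdge hch T hT with e | ⟨P, hP, Q, hQ, hPQ, hne, hQT⟩
    · obtain ⟨γ, hγ⟩ := key T hT A e
      exact ⟨.inr (.inl γ), Finset.mem_univ _, hγ.symm⟩
    rcases exists_change_after refEdge hch T hT with e | ⟨P', hP', Q', hQ', hPQ', hne', hQT'⟩
    · obtain ⟨γ, hγ⟩ := key T hT Z e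
      exact ⟨.inr (.inr γ), Finset.mem_univ _, hγ.symm⟩
    obtain ⟨K, hK, hd, z, hz, hzK⟩ := h𝒯₀.exists_node_of_chain hB hP hQ hQ' hPQ hne hPQ' hne'
      (hQT'.trans hQT.symm)
    obtain ⟨c, hcQ⟩ := hd.exists_eq_ofNode (h𝒯₀.gen_eq_zero K hK) hz
    rw [(hB Q hQ).1] at hcQ
    obtain ⟨i, hi⟩ : ∃ i : Fin 3, z = ![K.apex, K.left, K.right] i := by
      rcases hzK with rfl | rfl | rfl
      exacts [⟨0, rfl⟩, ⟨1, rfl⟩, ⟨2, rfl⟩]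
    obtain ⟨γ, hγ⟩ := key T hT Q hQT.symm
    refine ⟨.inl ((⟨K, hK⟩, i, (⟨K, hK⟩, c)), γ), Finset.mem_univ _, ?_⟩
    rw [hγ]
    simp only [F]
    rw [← hi, ← hcQ]
  rw [← List.toFinset_card_of_nodup hnd]
  exact (Finset.card_le_card hsub).trans (Finset.card_image_le.trans (by simp))

/-! ### The chains of elements along which the mesh closure spreads -/

/-- The list runs backwards, from the newest element R to T, so levels increase along it. Requiring
that e is not marked before step k keeps the elements distinct and forces the reference edge to
change at each step, which makes the level comparison applicable. -/
lemma exists_chain_of_mem_markedStep {𝒯₀ 𝒯 : Set (Element d)} (h𝒯₀ : IsInitialMesh 𝒯₀)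
    (h𝒯 : IsRefinement 𝒯₀ 𝒯) {T : Element d} (hT : T ∈ 𝒯) (k : ℕ) :
    ∀ e ∈ markedStep 𝒯 {T} k, (∀ j < k, e ∉ markedStep 𝒯 {T} j) →
      ∃ R c, R.refEdge = e ∧ (R :: c).Nodup ∧
        (∀ A ∈ R :: c, A ∈ 𝒯 ∧ (∃ j ≤ k, A.refEdge ∈ markedStep 𝒯 {T} j) ∧
          R.gen ≤ A.gen ∧ A.gen ≤ T.gen) ∧
        (R :: c).IsChain (fun A B => IsRefNeighbor 𝒯 B A ∧ A.gen ≤ B.gen) ∧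
        ∀ p ∈ R.body, ∃ t ∈ T.body, dist p t ≤ ((R :: c).map diam).sum := by
  induction k with
  | zero =>
    rintro e ⟨S, rfl, rfl⟩ -
    refine ⟨S, [], rfl, by simp, ?_, by simp, fun p hp => ⟨p, hp, ?_⟩⟩
    · intro A hA
      obtain rfl : A = S := by simpa using hA
      exact ⟨hT, ⟨0, le_rfl, A, rfl, rfl⟩, le_rfl, le_rfl⟩
    · simpa using S.dist_le_diam hp hp
  | succ k ih =>
    rintro e ⟨S, hS, ⟨e', he', heS⟩, rfl⟩ hmin
    have hmin' : ∀ j < k, e' ∉ markedStep 𝒯 {T} j :=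
      fun j hj h => hmin (j + 1) (by omega) ⟨S, hS, ⟨e', h, heS⟩, rfl⟩
    obtain ⟨R, c, rfl, hnd, hmem, hch, hdist⟩ := ih e' he' hmin'
    have hR := hmem R (by simp)
    have hne : R.refEdge ≠ S.refEdge := fun h => hmin k (by omega) (h ▸ he')
    obtain ⟨K, hK, hKR⟩ := h𝒯.exists_descends R hR.1
    obtain ⟨K', hK', hKS⟩ := h𝒯.exists_descends S hS
    have hgen := (h𝒯₀.gen_le_of_refEdge_mem hK hK' hKR hKS heS hne).1
    refine ⟨S, R :: c, rfl, ?_, ?_, ?_, ?_⟩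
    · refine List.nodup_cons.2 ⟨fun h => ?_, hnd⟩
      obtain ⟨j, hj, hjS⟩ := (hmem S h).2.1
      exact hmin j (by omega) hjS
    · intro A hA
      rcases List.mem_cons.1 hA with rfl | hA
      · exact ⟨hS, ⟨k + 1, le_rfl, A, hS, ⟨_, he', heS⟩, rfl⟩, le_rfl, hgen.trans hR.2.2.2⟩
      · obtain ⟨h1, ⟨j, hj, h2⟩, h3, h4⟩ := hmem A hA
        exact ⟨h1, ⟨j, by omega, h2⟩, hgen.trans h3, h4⟩
    · exact List.isChain_cons_cons.2
        ⟨⟨⟨hS, fun h => hne (congrArg refEdge h).symm, heS⟩, hgen⟩, hch⟩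
    · intro p hp
      have hz : R.left ∈ S.body :=
        S.nodes_subset_body (mem_nodes_of_mem_edges (show s(R.left, R.right) ∈ _ from heS)).1
      obtain ⟨t, ht, hd⟩ := hdist R.left (R.nodes_subset_body (by simp [nodes]))
      refine ⟨t, ht, ?_⟩
      rw [List.map_cons, List.sum_cons]
      exact (dist_triangle p R.left t).trans (add_le_add (S.dist_le_diam hp hz) hd)

/-- The elements of one level form a chain, if the level is monotone along a chain. -/
lemma isChain_filter_of_monotone {α : Type*} {r : α → α → Prop} (f : α → ℕ) (g : ℕ) :
    ∀ {l : List α}, l.IsChain (fun a b => r a b ∧ f a ≤ f b) →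
      (l.filter fun a => f a = g).IsChain r
  | [], _ => by simp
  | a :: l, h => by
    have ih := isChain_filter_of_monotone f g (List.IsChain.tail h)
    simp only [List.tail_cons] at ih
    by_cases ha : f a = g
    · rw [List.filter_cons_of_pos (by simpa using ha)]
      rcases l with _ | ⟨b, l⟩
      · simp
      obtain ⟨hab, hl⟩ := List.isChain_cons_cons.1 h
      by_cases hb : f b = g
      · rw [List.filter_cons_of_pos (by simpa using hb)] at ih ⊢
        exact List.isChain_cons_cons.2 ⟨hab.1, ih⟩
      -- Once the level has passed g, it never returns.
      · have hbl : ((b :: l).map f).Pairwise (· ≤ ·) := by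
          rw [← List.isChain_iff_pairwise, List.isChain_map]
          exact hl.imp fun _ _ h => h.2
        rw [List.map_cons, List.pairwise_cons] at hbl
        have : (b :: l).filter (fun a => f a = g) = [] := by
          rw [List.filter_eq_nil_iff]
          intro x hx
          have : f b ≤ f x := by
            rcases List.mem_cons.1 hx with rfl | hx
            · exact le_rfl
            · exact hbl.1 _ (List.mem_map_of_mem hx)
          have := hab.2
          simp only [decide_eq_true_eq]
          omega
        rw [this]
        simp
    · rwa [List.filter_cons_of_neg (by simpa using ha)]

lemma sum_diam_le {𝒯₀ 𝒯 : Set (Element d)} {C : ℝ} {N : ℕ} (hC : IsDiamConst 𝒯₀ C)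
    (hN : IsChainConst 𝒯₀ N) (h𝒯 : IsRefinement 𝒯₀ 𝒯) {c : List (Element d)} {m n : ℕ}
    (hc : ∀ A ∈ c, A ∈ 𝒯 ∧ m ≤ A.gen ∧ A.gen ≤ n) (hnd : c.Nodup)
    (hch : c.IsChain (fun A B => IsRefNeighbor 𝒯 B A ∧ A.gen ≤ B.gen)) :
    (c.map diam).sum ≤ N * C * ∑ k ∈ Finset.Icc m n, ((2 : ℝ) ^ (-(1 / 2) : ℝ)) ^ k := by
  classical
  have hcard : ∀ g, (c.toFinset.filter fun A => A.gen = g).card ≤ N := by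
    intro g
    -- The elements of level g are consecutive in the list; reversing them gives the orientation
    -- required by `IsChainConst`.
    have h1 := isChain_filter_of_monotone (r := fun A B => IsRefNeighbor 𝒯 B A) gen g hch
    have h2 := hN 𝒯 h𝒯 g (c.filter fun A => A.gen = g).reverse (fun A hA => by
        simp only [List.mem_reverse, List.mem_filter, decide_eq_true_eq] at hA
        exact ⟨(hc A hA.1).1, hA.2⟩)
      (List.nodup_reverse.2 (hnd.filter _)) (List.isChain_reverse.2 h1)
    rw [List.length_reverse] at h2
    have e : (c.toFinset.filter fun A => A.gen = g) = (c.filter fun A => A.gen = g).toFinset := by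
      ext; simp
    rw [e]
    exact (List.toFinset_card_le _).trans h2
  rw [← List.sum_toFinset _ hnd, ← Finset.sum_fiberwise_of_maps_to
    (s := c.toFinset) (t := Finset.Icc m n) (g := gen) (fun A hA => Finset.mem_Icc.2
      (hc A (List.mem_toFinset.1 hA)).2), Finset.mul_sum]
  refine Finset.sum_le_sum fun g _ => ?_
  have hnn : 0 ≤ C * ((2 : ℝ) ^ (-(1 / 2) : ℝ)) ^ g := mul_nonneg hC.1.le (by positivity)
  calc _ ≤ (c.toFinset.filter fun A => A.gen = g).card • (C * ((2 : ℝ) ^ (-(1 / 2) : ℝ)) ^ g) := by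
        refine Finset.sum_le_card_nsmul _ _ _ fun A hA => ?_
        rw [Finset.mem_filter, List.mem_toFinset] at hA
        have := hC.2 𝒯 h𝒯 A (hc A hA.1).1
        rwa [two_rpow_neg_half, hA.2] at this
    _ ≤ N * C * _ := by
        rw [nsmul_eq_mul, mul_assoc]
        gcongr
        exact hcard g

/-! ### Distance from the marked element to the new elements -/

lemma elementDist_le {T T' : Element d} {p q : EuclideanSpace ℝ (Fin d)} (hp : p ∈ T.body)
    (hq : q ∈ T'.body) : elementDist T T' ≤ dist p q := by
  refine csInf_le ⟨0, ?_⟩ ⟨p, hp, q, hq, rfl⟩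
  rintro _ ⟨x, -, y, -, rfl⟩
  exact dist_nonneg

lemma refEdge_mem_edges_of_mem_sons {S B : Element d} (h : B ∈ S.sons) (hS : S.LegsIndep) :
    B.refEdge ∈ S.edges ∧ B.refEdge ≠ S.refEdge := by
  rcases h with rfl | rfl
  · refine ⟨.inr (.inl rfl), fun h => ?_⟩
    rcases Sym2.eq_iff.1 h with ⟨h, -⟩ | ⟨h, -⟩
    exacts [hS.apex_ne_left h, hS.apex_ne_right h]
  · refine ⟨.inr (.inr rfl), fun h => ?_⟩
    rcases Sym2.eq_iff.1 h with ⟨h, -⟩ | ⟨h, -⟩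
    exacts [hS.apex_ne_left h, hS.apex_ne_right h]

/-- Each new element is contained in an old element `S`, which contains the reference edge of the
last element `R` of a chain of reference neighbours that starts with the marked element. -/
lemma exists_chain_of_mem_refineNVB {𝒯₀ 𝒯 : Set (Element d)} (h𝒯₀ : IsInitialMesh 𝒯₀)
    (h𝒯 : IsRefinement 𝒯₀ 𝒯) {T T' : Element d} (hT : T ∈ 𝒯) (hT' : T' ∈ refineNVB 𝒯 {T} \ 𝒯) :
    ∃ S ∈ 𝒯, T'.body ⊆ S.body ∧ T'.gen ≤ S.gen + 2 ∧ ∃ R c, R.refEdge ∈ S.edges ∧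
      T'.gen ≤ R.gen + 2 ∧ (R :: c).Nodup ∧
      (∀ A ∈ R :: c, A ∈ 𝒯 ∧ R.gen ≤ A.gen ∧ A.gen ≤ T.gen) ∧
      (R :: c).IsChain (fun A B => IsRefNeighbor 𝒯 B A ∧ A.gen ≤ B.gen) ∧
      ∀ p ∈ R.body, ∃ t ∈ T.body, dist p t ≤ ((R :: c).map diam).sum := by
  classical
  have key : ∀ e ∈ markedEdges 𝒯 {T}, ∃ R c, R.refEdge = e ∧ (R :: c).Nodup ∧
      (∀ A ∈ R :: c, A ∈ 𝒯 ∧ R.gen ≤ A.gen ∧ A.gen ≤ T.gen) ∧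
      (R :: c).IsChain (fun A B => IsRefNeighbor 𝒯 B A ∧ A.gen ≤ B.gen) ∧
      ∀ p ∈ R.body, ∃ t ∈ T.body, dist p t ≤ ((R :: c).map diam).sum := by
    intro e he
    have he' : ∃ k, e ∈ markedStep 𝒯 {T} k := Set.mem_iUnion.1 he
    obtain ⟨R, c, h1, h2, h3, h4, h5⟩ := exists_chain_of_mem_markedStep h𝒯₀ h𝒯 hT
      (Nat.find he') e (Nat.find_spec he') (fun j hj => Nat.find_min he' hj)
    exact ⟨R, c, h1, h2, fun A hA => ⟨(h3 A hA).1, (h3 A hA).2.2⟩, h4, h5⟩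
  obtain ⟨hT', hnew⟩ := hT'
  simp only [refineNVB, refineElement, Set.mem_iUnion] at hT'
  obtain ⟨S, hS, B, hB, hT'⟩ := hT'
  obtain ⟨K, hK, hKS⟩ := h𝒯.exists_descends S hS
  rcases hB with ⟨hSM, rfl⟩ | ⟨hSM, hB⟩
  · rcases hT' with ⟨-, rfl⟩ | ⟨hM, -⟩
    exacts [absurd hS hnew, absurd hM hSM]
  have hgB := (legs_of_mem_sons hB).1
  rcases hT' with ⟨-, rfl⟩ | ⟨hBM, hT'⟩
  · obtain ⟨R, c, h1, h2, h3, h4, h5⟩ := key _ hSM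
    obtain ⟨K', hK', hKR⟩ := h𝒯.exists_descends R (h3 R (by simp)).1
    -- Only one bisection happened here, so it is enough that S is at most one level above R.
    have hg := h𝒯₀.gen_le_of_refEdge_eq hK' hK hKR hKS h1
    exact ⟨S, hS, body_subset_of_mem_sons hB, by omega, R, c, h1 ▸ S.refEdge_mem_edges, by omega,
      h2, h3, h4, h5⟩
  · obtain ⟨R, c, h1, h2, h3, h4, h5⟩ := key _ hBM
    obtain ⟨K', hK', hKR⟩ := h𝒯.exists_descends R (h3 R (by simp)).1
    obtain ⟨he, hne⟩ := refEdge_mem_edges_of_mem_sons hB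
      (hKS.legsIndep (h𝒯₀.nondegenerate K hK).legsIndep)
    rw [← h1] at he hne
    -- After two bisections the full bound gen(S) ≤ gen(R) is needed; it holds since the edge is a
    -- leg of S.
    have hg := (h𝒯₀.gen_le_of_refEdge_mem hK' hK hKR hKS he hne).1
    have hgT := (legs_of_mem_sons hT').1
    exact ⟨S, hS, (body_subset_of_mem_sons hT').trans (body_subset_of_mem_sons hB), by omega,
      R, c, he, by omega, h2, h3, h4, h5⟩

lemma elementDist_le_of_mem_refineNVB {𝒯₀ 𝒯 : Set (Element d)} (h𝒯₀ : IsInitialMesh 𝒯₀)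
    {C : ℝ} {N : ℕ} (hC : IsDiamConst 𝒯₀ C) (hN : IsChainConst 𝒯₀ N) (h𝒯 : IsRefinement 𝒯₀ 𝒯)
    {T T' : Element d} (hT : T ∈ 𝒯) (hT' : T' ∈ refineNVB 𝒯 {T} \ 𝒯) :
    T'.gen ≤ T.gen + 2 ∧ elementDist T T' ≤ (2 * (N : ℝ) + 2) * C *
      ∑ k ∈ Finset.Icc T'.gen (T.gen + 2), ((2 : ℝ) ^ (-(1 / 2) : ℝ)) ^ k := by
  obtain ⟨S, hS, hbody, hgS, R, c, hRS, hgR, hnd, hmem, hch, hdist⟩ :=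
    exists_chain_of_mem_refineNVB h𝒯₀ h𝒯 hT hT'
  have hRT := (hmem R (by simp)).2.2
  refine ⟨by omega, ?_⟩
  have hsum := sum_diam_le hC hN h𝒯 hmem hnd hch
  have hdS := hC.2 𝒯 h𝒯 S hS
  rw [two_rpow_neg_half] at hdS
  have hq1 : (2 : ℝ) ^ (-(1 / 2) : ℝ) ≤ 1 :=
    Real.rpow_le_one_of_one_le_of_nonpos (by norm_num) (by norm_num)
  have hq0 : 0 < (2 : ℝ) ^ (-(1 / 2) : ℝ) := by positivity
  have hq2 := rpow_neg_half_sq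
  set q : ℝ := (2 : ℝ) ^ (-(1 / 2) : ℝ)
  have hz : R.left ∈ S.body :=
    S.nodes_subset_body (mem_nodes_of_mem_edges (show s(R.left, R.right) ∈ _ from hRS)).1
  obtain ⟨t, ht, hd⟩ := hdist R.left (R.nodes_subset_body (by simp [nodes]))
  have ha : T'.apex ∈ T'.body := T'.nodes_subset_body (by simp [nodes])
  have hd' := S.dist_le_diam (hbody ha) hz
  -- As q^2 = 1/2, shifting the index by 2 costs the factor 2, and gen(T') ≤ gen(R) + 2 allows the
  -- sum to start at gen(T').
  have hshift : ∑ k ∈ Finset.Icc R.gen T.gen, q ^ k ≤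
      2 * ∑ k ∈ Finset.Icc T'.gen (T.gen + 2), q ^ k := by
    have : ∑ k ∈ Finset.Icc R.gen T.gen, q ^ k =
        2 * ∑ k ∈ Finset.Icc (R.gen + 2) (T.gen + 2), q ^ k := by
      rw [← Finset.map_add_right_Icc, Finset.sum_map, Finset.mul_sum]
      refine Finset.sum_congr rfl fun k _ => ?_
      simp only [addRightEmbedding_apply, pow_add, hq2]
      ring
    rw [this]
    gcongr
  have hlast : q ^ S.gen ≤ 2 * ∑ k ∈ Finset.Icc T'.gen (T.gen + 2), q ^ k := by
    have h1 : q ^ S.gen = 2 * q ^ (S.gen + 2) := by rw [pow_add, hq2]; ring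
    have h2 : q ^ (S.gen + 2) ≤ q ^ T'.gen := pow_le_pow_of_le_one hq0.le hq1 hgS
    have h3 : q ^ T'.gen ≤ ∑ k ∈ Finset.Icc T'.gen (T.gen + 2), q ^ k :=
      Finset.single_le_sum (f := fun k => q ^ k) (fun k _ => by positivity)
        (Finset.mem_Icc.2 ⟨le_rfl, by omega⟩)
    linarith
  have hC0 := hC.1
  calc elementDist T T' ≤ dist t T'.apex := elementDist_le ht ha
    _ ≤ dist T'.apex R.left + dist R.left t := by
      rw [dist_comm]; exact dist_triangle _ _ _
    _ ≤ C * q ^ S.gen + N * C * ∑ k ∈ Finset.Icc R.gen T.gen, q ^ k :=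
      add_le_add (hd'.trans hdS) (hd.trans hsum)
    _ ≤ C * (2 * ∑ k ∈ Finset.Icc T'.gen (T.gen + 2), q ^ k) +
        N * C * (2 * ∑ k ∈ Finset.Icc T'.gen (T.gen + 2), q ^ k) := by gcongr
    _ = _ := by ring

end NVB

theorem lemma18 {d : ℕ} (𝒯₀ : Set (NVB.Element d)) (h𝒯₀ : NVB.IsInitialMesh 𝒯₀) :
    (∃ Cdiam : ℝ, NVB.IsDiamConst 𝒯₀ Cdiam) ∧
    (∃ Cchain : ℕ, NVB.IsChainConst 𝒯₀ Cchain) ∧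
    ∀ (Cdiam : ℝ) (Cchain : ℕ) (Cdist : ℝ),
      NVB.IsDiamConst 𝒯₀ Cdiam → NVB.IsChainConst 𝒯₀ Cchain →
      Cdist = 2 * (Cchain : ℝ) + (2 : ℝ) ^ (3 / 2 : ℝ) →
      ∀ 𝒯, NVB.IsRefinement 𝒯₀ 𝒯 → ∀ T ∈ 𝒯, ∀ T' ∈ NVB.refineNVB 𝒯 {T} \ 𝒯,
        T'.gen ≤ T.gen + 2 ∧
        NVB.elementDist T T' ≤
          Cdist * Cdiam * ∑ k ∈ Finset.Icc T'.gen (T.gen + 2), (2 : ℝ) ^ (-(k : ℝ) / 2) ∧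
        Cdist * Cdiam * ∑ k ∈ Finset.Icc T'.gen (T.gen + 2), (2 : ℝ) ^ (-(k : ℝ) / 2) ≤
          Cdist * Cdiam / (1 - (2 : ℝ) ^ (-(1 / 2) : ℝ)) * (2 : ℝ) ^ (-(T'.gen : ℝ) / 2) := by
  refine ⟨NVB.exists_isDiamConst h𝒯₀, NVB.exists_isChainConst h𝒯₀, ?_⟩
  rintro C N _ hC hN rfl 𝒯 h𝒯 T hT T' hT'
  obtain ⟨hgen, hdist⟩ := NVB.elementDist_le_of_mem_refineNVB h𝒯₀ hC hN h𝒯 hT hT'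
  have hC0 := hC.1
  -- The argument gives the constant 2 C_chain + 2, which is below C_dist.
  have h2 : (2 : ℝ) ≤ (2 : ℝ) ^ (3 / 2 : ℝ) := by
    simpa using Real.rpow_le_rpow_of_exponent_le (x := 2) (by norm_num)
      (show (1 : ℝ) ≤ 3 / 2 by norm_num)
  simp only [NVB.two_rpow_neg_half]
  refine ⟨hgen, hdist.trans (by gcongr), ?_⟩
  have hq0 : (0 : ℝ) ≤ (2 : ℝ) ^ (-(1 / 2) : ℝ) := by positivity
  have hq1 : (2 : ℝ) ^ (-(1 / 2) : ℝ) < 1 :=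
    Real.rpow_lt_one_of_one_lt_of_neg (by norm_num) (by norm_num)
  rw [div_mul_eq_mul_div, mul_div_assoc, ← Finset.Ico_add_one_right_eq_Icc]
  gcongr
  exact geom_sum_Ico_le_of_lt_one hq0 hq1
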